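/- Let $S$ be a finite nonempty set and let $b:2^S\to\mathbb{R}\cup\{+\infty\}$ be a set function with $b(\emptyset)=0$ that is submodular, i.e. $b(X)+b(Y)\ge b(X\cap Y)+b(X\cup Y)$ whenever $b(X),b(Y)<+\infty$. The base-polyhedron defined by $b$ is $$B=\Big\{x\in\mathbb{R}^S:\ \sum_{s\in S}x(s)=b(S),\ \sum_{s\in Z}x(s)\le b(Z)\ \text{ for all } Z\subset S\Big\}.$$ It may be unbounded. Suppose that $B$ is nonempty and integral, i.e. $B$ is the convex hull of its integral points. For $x\in\mathbb{R}^S$ let $x{\downarrow}$ denote the vector of components of $x$ arranged in decreasing order. An element $m$ of a set $Q\subseteq\mathbb{R}^S$ is decreasingly minimal (dec-min) in $Q$ if, for every $y\in Q$, either $m{\downarrow}=y{\downarrow}$ or $m{\downarrow}$ is smaller than $y{\downarrow}$ in the first component in which they differ. **Theorem (Proximity).** Let $m_{\mathbb{R}}$ be the minimum norm point of $B$, i.e. the point of $B$ minimizing $\sum_{s\in S}x(s)^2$. Then every dec-min element $m_{\mathbb{Z}}$ of the M-convex set $B\cap\mathbb{Z}^S$ satisfies $$\lfloor m_{\mathbb{R}}(s)\rfloor\le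 m_{\mathbb{Z}}(s)\le\lceil m_{\mathbb{R}}(s)\rceil\qquad\text{for all } s\in S .$$ -/

import Mathlib

namespace DecMin

section Dec

variable {S α : Type*} [Fintype S] [LinearOrder α]

/-- The components of `x` rearranged in decreasing order. -/
def sortDown (x : S → α) : List α :=
  (Finset.univ.val.map x).sort (· ≥ ·)

/-- `x` is decreasingly smaller than `y`: at the first position where the two decreasing
rearrangements (lists of equal length) differ, the one of `x` has the smaller entry. -/
def DecLT (x y : S → α) : Prop :=
  List.Lex (· < ·) (sortDown x) (sortDown y)

/-- `x` is decreasingly smaller than, or value-equivalent to, `y`. -/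
def DecLE (x y : S → α) : Prop :=
  DecLT x y ∨ sortDown x = sortDown y

/-- `m` is a decreasingly minimal element of `Q`. -/
def IsDecMin (Q : Set (S → α)) (m : S → α) : Prop :=
  m ∈ Q ∧ ∀ y ∈ Q, DecLE m y

end Dec

section Base

variable {S : Type*}

/-- Submodularity of a set function with values in `ℝ ∪ {+∞}`. -/
def IsSubmodular [DecidableEq S] (b : Finset S → WithTop ℝ) : Prop :=
  ∀ X Y : Finset S, b X ≠ ⊤ → b Y ≠ ⊤ → b (X ∩ Y) + b (X ∪ Y) ≤ b X + b Y

/-- The polyhedron `{x | x(V) = b(V) for the ground set V, x(Z) ≤ b(Z) for all Z}`. -/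
def basePolyhedron [Fintype S] (b : Finset S → WithTop ℝ) : Set (S → ℝ) :=
  {x | ((∑ v, x v : ℝ) : WithTop ℝ) = b Finset.univ ∧
    ∀ Z : Finset S, ((∑ v ∈ Z, x v : ℝ) : WithTop ℝ) ≤ b Z}

/-- `B` is a (possibly unbounded) base-polyhedron. -/
def IsBasePolyhedron [Fintype S] [DecidableEq S] (B : Set (S → ℝ)) : Prop :=
  ∃ b : Finset S → WithTop ℝ, b ∅ = 0 ∧ IsSubmodular b ∧ B = basePolyhedron b

/-- The set of integral members of `B`, as integer vectors. -/
def integralPoints (B : Set (S → ℝ)) : Set (S → ℤ) :=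
  {z | (fun s => (z s : ℝ)) ∈ B}

/-- `B` is the convex hull of its integral members. -/
def IsIntegralPolyhedron (B : Set (S → ℝ)) : Prop :=
  convexHull ℝ ((fun (z : S → ℤ) (s : S) => (z s : ℝ)) '' integralPoints B) = B

/-- An integral base-polyhedron: a base-polyhedron that is an integral polyhedron. -/
def IsIntegralBasePolyhedron [Fintype S] [DecidableEq S] (B : Set (S → ℝ)) : Prop :=
  IsBasePolyhedron B ∧ IsIntegralPolyhedron B

/-- `m` is a point of `B` of minimum Euclidean norm (minimum square-sum). -/
def IsMinNormPoint [Fintype S] (B : Set (S → ℝ)) (m : S → ℝ) : Prop :=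
  m ∈ B ∧ ∀ x ∈ B, ∑ s, m s ^ 2 ≤ ∑ s, x s ^ 2

end Base

end DecMin

/-! If `mZ s + 1 ≤ mR s`, simultaneous exchange (`exists_exchange`) gives `t` with `mR t < mZ t`
such that a little can move from `s` to `t` in `mR` and from `t` to `s` in `mZ`. Minimality of the
norm forces `mR s ≤ mR t`. By integrality the move in `mZ` extends to a unit step
(`transfer_one_mem`), so dec-minimality forces `mZ t ≤ mZ s + 1`. Hence `mZ t ≤ mZ s + 1 ≤ mR s ≤ mR
t < mZ t`, a contradiction. The upper bound is symmetric. -/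

namespace DecMin

/-! ### Comparison of decreasing rearrangements -/

section Dec

variable {α : Type*} [LinearOrder α]

theorem sort_add_of_forall_ge {A C : Multiset α} (h : ∀ a ∈ A, ∀ c ∈ C, a ≥ c) :
    (A + C).sort (· ≥ ·) = A.sort (· ≥ ·) ++ C.sort (· ≥ ·) := by
  refine List.Perm.eq_of_pairwise (le := (· ≥ ·)) (fun a b _ _ h₁ h₂ => le_antisymm h₂ h₁)
    (Multiset.pairwise_sort _ _) ?_ ?_
  · rw [List.pairwise_append]
    exact ⟨Multiset.pairwise_sort _ _, Multiset.pairwise_sort _ _, fun a ha c hc =>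
      h a ((Multiset.mem_sort _).1 ha) c ((Multiset.mem_sort _).1 hc)⟩
  · rw [← Multiset.coe_eq_coe, ← Multiset.coe_add]
    simp only [Multiset.sort_eq]

theorem DecLT.not_decLE {S : Type*} [Fintype S] {x y : S → α} (h : DecLT y x) : ¬ DecLE x y := by
  have h' : sortDown y < sortDown x := h
  rintro (h₁ | h₁)
  · exact lt_asymm h' h₁
  · exact h'.ne' h₁

/-- Lowering the largest of two components, and raising the other one to a value that is still
below it, decreases the vector. -/
theorem decLT_of_transfer {S : Type*} [Fintype S] {x y : S → α} {s t : S}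
    (hst : s ≠ t) (hs : y s < x s) (ht : y t < x s) (hxt : x t < x s)
    (hr : ∀ r, r ≠ s → r ≠ t → y r = x r) : DecLT y x := by
  classical
  obtain ⟨R, hR⟩ : ∃ R : Multiset S, Finset.univ.val = s ::ₘ t ::ₘ R := by
    obtain ⟨R₁, h₁⟩ := Multiset.exists_cons_of_mem (Finset.mem_univ_val s)
    have ht' : t ∈ R₁ := by
      have := Finset.mem_univ_val t
      rw [h₁, Multiset.mem_cons] at this
      exact this.resolve_left hst.symm
    obtain ⟨R, h₂⟩ := Multiset.exists_cons_of_mem ht'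
    exact ⟨R, h₂ ▸ h₁⟩
  have hnd : (s ::ₘ t ::ₘ R).Nodup := hR ▸ Finset.univ.nodup
  rw [Multiset.nodup_cons, Multiset.nodup_cons, Multiset.mem_cons, not_or] at hnd
  obtain ⟨⟨-, hsR⟩, htR, -⟩ := hnd
  have hmap : R.map y = R.map x := Multiset.map_congr rfl fun r h =>
    hr r (fun e => hsR (e ▸ h)) (fun e => htR (e ▸ h))
  -- Both rearrangements begin with `A`; the next entry is `x s` for `x`, while all that remains of
  -- `y` is below `x s`.
  set A := (R.map x).filter (x s ≤ ·) with hA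
  set C := (R.map x).filter (¬ x s ≤ ·) with hC
  have hAC : R.map x = A + C := (Multiset.filter_add_not _ _).symm
  have hmemA : ∀ a ∈ A, x s ≤ a := fun a h => (Multiset.mem_filter.1 h).2
  have hmemC : ∀ c ∈ C, c < x s := fun c h => not_le.1 (Multiset.mem_filter.1 h).2
  have hx : sortDown x =
      A.sort (· ≥ ·) ++ (({x s} : Multiset α).sort (· ≥ ·) ++ (x t ::ₘ C).sort (· ≥ ·)) := by
    have hlt : ∀ c ∈ x t ::ₘ C, c < x s := by
      simp only [Multiset.mem_cons, forall_eq_or_imp]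
      exact ⟨hxt, hmemC⟩
    rw [← sort_add_of_forall_ge, ← sort_add_of_forall_ge, sortDown, hR, Multiset.map_cons,
      Multiset.map_cons, hAC]
    · congr 1
      simp only [← Multiset.singleton_add]
      abel
    · intro a ha c hc
      rcases Multiset.mem_add.1 hc with hc | hc
      · exact (Multiset.mem_singleton.1 hc).le.trans (hmemA a ha)
      · exact (hlt c hc).le.trans (hmemA a ha)
    · intro a ha c hc
      exact (hlt c hc).le.trans (Multiset.mem_singleton.1 ha).ge
  have hlt : ∀ c ∈ y s ::ₘ y t ::ₘ C, c < x s := by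
    simp only [Multiset.mem_cons, forall_eq_or_imp]
    exact ⟨hs, ht, hmemC⟩
  have hy : sortDown y = A.sort (· ≥ ·) ++ (y s ::ₘ y t ::ₘ C).sort (· ≥ ·) := by
    rw [← sort_add_of_forall_ge, sortDown, hR, Multiset.map_cons, Multiset.map_cons, hmap, hAC]
    · congr 1
      simp only [← Multiset.singleton_add]
      abel
    · exact fun a ha c hc => (hlt c hc).le.trans (hmemA a ha)
  unfold DecLT
  rw [hx, hy, Multiset.sort_singleton]
  refine List.Lex.append_left _ ?_ _
  cases hL : (y s ::ₘ y t ::ₘ C).sort (· ≥ ·) with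
  | nil => exact List.Lex.nil
  | cons c L =>
    refine List.Lex.rel (hlt c ?_)
    rw [← Multiset.mem_sort (r := (· ≥ ·)), hL]
    exact List.mem_cons_self

end Dec

/-! ### Tight sets, exchange and unit steps in base-polyhedra -/

section Base

variable {S : Type*} [DecidableEq S]

/-- The vector `x` with `a` units moved from component `s` to component `t`. -/
def transfer {R : Type*} [Ring R] (x : S → R) (s t : S) (a : R) : S → R :=
  x + Pi.single t a - Pi.single s a

theorem sum_transfer {R : Type*} [Ring R] (x : S → R) (s t : S) (a : R) (Z : Finset S) :
    ∑ v ∈ Z, transfer x s t a v =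
      ∑ v ∈ Z, x v + (if t ∈ Z then a else 0) - (if s ∈ Z then a else 0) := by
  simp [transfer, Finset.sum_add_distrib, Finset.sum_sub_distrib]

variable [Fintype S] {b : Finset S → WithTop ℝ}

/-- `Z` is tight for `x`. -/
def IsTight (b : Finset S → WithTop ℝ) (x : S → ℝ) (Z : Finset S) : Prop :=
  ((∑ v ∈ Z, x v : ℝ) : WithTop ℝ) = b Z

/-- Uncrossing: the slacks of `X ∩ Y` and `X ∪ Y` are nonnegative, and by submodularity their sum is
at most zero. -/
theorem IsTight.inter_union (hb : IsSubmodular b) {x : S → ℝ} (hx : x ∈ basePolyhedron b)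
    {X Y : Finset S} (hX : IsTight b x X) (hY : IsTight b x Y) :
    IsTight b x (X ∩ Y) ∧ IsTight b x (X ∪ Y) := by
  have h := hb X Y (hX ▸ WithTop.coe_ne_top) (hY ▸ WithTop.coe_ne_top)
  have h₁ := hx.2 (X ∩ Y)
  have h₂ := hx.2 (X ∪ Y)
  have h₃ := Finset.sum_union_inter (s₁ := X) (s₂ := Y) (f := x)
  unfold IsTight at *
  rw [← hX, ← hY] at h
  generalize b (X ∩ Y) = p at *
  generalize b (X ∪ Y) = q at *
  induction p with
  | top => simp at h
  | coe p =>
    induction q with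
    | top => simp at h
    | coe q =>
      norm_cast at *
      constructor <;> linarith

/-- If every tight set containing `t` contains `s`, a small amount can be moved from `s` to `t`. -/
theorem exists_transfer_mem {x : S → ℝ} (hx : x ∈ basePolyhedron b) {s t : S}
    (h : ∀ Z, IsTight b x Z → t ∈ Z → s ∈ Z) :
    ∃ ε > 0, ∀ a, 0 ≤ a → a ≤ ε → transfer x s t a ∈ basePolyhedron b := by
  have key : ∀ Z : Finset S, ∃ ε > 0, ∀ a : ℝ, 0 ≤ a → a ≤ ε →
      ((∑ v ∈ Z, transfer x s t a v : ℝ) : WithTop ℝ) ≤ b Z := by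
    intro Z
    have hZ := hx.2 Z
    simp only [sum_transfer]
    -- Only sets containing `t` but not `s` gain weight; their slack bounds the step.
    by_cases ht : t ∈ Z ∧ s ∉ Z
    · have hne : ((∑ v ∈ Z, x v : ℝ) : WithTop ℝ) ≠ b Z := fun e => ht.2 (h Z e ht.1)
      have hlt := lt_of_le_of_ne hZ hne
      generalize b Z = p at *
      induction p with
      | top => exact ⟨1, one_pos, fun _ _ _ => le_top⟩
      | coe p =>
        norm_cast at *
        refine ⟨p - ∑ v ∈ Z, x v, by linarith, fun a _ ha => ?_⟩
        simp only [ht.1, ht.2, if_true, if_false]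
        linarith
    · refine ⟨1, one_pos, fun a ha _ => le_trans (WithTop.coe_le_coe.2 ?_) hZ⟩
      by_cases hs : s ∈ Z <;> by_cases ht' : t ∈ Z <;> simp_all
  choose ε hε hmem using key
  refine ⟨Finset.univ.inf' Finset.univ_nonempty ε, ?_, fun a ha hle => ⟨?_, fun Z => ?_⟩⟩
  · simpa [Finset.lt_inf'_iff] using hε
  · rw [sum_transfer]
    simpa using hx.1
  · exact hmem Z a ha (hle.trans (Finset.inf'_le _ (Finset.mem_univ Z)))

/-- Simultaneous exchange property of base-polyhedra. -/
theorem exists_exchange (hb₀ : b ∅ = 0) (hb : IsSubmodular b) {x y : S → ℝ}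
    (hx : x ∈ basePolyhedron b) (hy : y ∈ basePolyhedron b) {s : S} (hs : y s < x s) :
    ∃ t, x t < y t ∧ (∃ ε > 0, ∀ a, 0 ≤ a → a ≤ ε → transfer x s t a ∈ basePolyhedron b) ∧
      ∃ ε > 0, ∀ a, 0 ≤ a → a ≤ ε → transfer y t s a ∈ basePolyhedron b := by
  classical
  let 𝒟 := (Finset.univ : Finset (Finset S)).filter fun Z => IsTight b y Z ∧ s ∈ Z
  let ℰ := (Finset.univ : Finset (Finset S)).filter fun Z => IsTight b x Z ∧ s ∉ Z
  obtain ⟨D, hD⟩ := 𝒟.exists_minimal ⟨Finset.univ, by simpa [𝒟, IsTight] using hy.1⟩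
  obtain ⟨E, hE⟩ := ℰ.exists_maximal ⟨∅, by simp [ℰ, IsTight, hb₀]⟩
  obtain ⟨hDt, hsD⟩ := (Finset.mem_filter.1 hD.prop).2
  obtain ⟨hEt, hsE⟩ := (Finset.mem_filter.1 hE.prop).2
  have hD' : ∀ Z, IsTight b y Z → s ∈ Z → D ⊆ Z := fun Z hZ hsZ =>
    (hD.le_of_le (y := D ∩ Z) (Finset.mem_filter.2 ⟨Finset.mem_univ _,
      (hDt.inter_union hb hy hZ).1, Finset.mem_inter.2 ⟨hsD, hsZ⟩⟩)
      Finset.inter_subset_left).trans Finset.inter_subset_right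
  have hE' : ∀ Z, IsTight b x Z → s ∉ Z → Z ⊆ E := fun Z hZ hsZ =>
    Finset.subset_union_right.trans (hE.le_of_ge (y := E ∪ Z) (Finset.mem_filter.2
      ⟨Finset.mem_univ _, (hEt.inter_union hb hx hZ).2, by simp [hsE, hsZ]⟩)
      Finset.subset_union_left)
  obtain ⟨t, htD, htE, ht⟩ : ∃ t, t ∈ D ∧ t ∉ E ∧ x t < y t := by
    -- Otherwise `y(D \ E) < x(D \ E)`, whereas submodularity and tightness give `y(D ∩ E) + x(D ∪
    -- E) ≤ y(D) + x(E)`, the reverse inequality.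
    by_contra! hcon
    have hlt : ∑ v ∈ D \ E, y v < ∑ v ∈ D \ E, x v :=
      Finset.sum_lt_sum (fun v hv => hcon v (Finset.mem_sdiff.1 hv).1 (Finset.mem_sdiff.1 hv).2)
        ⟨s, Finset.mem_sdiff.2 ⟨hsD, hsE⟩, hs⟩
    have h := hb D E (hDt ▸ WithTop.coe_ne_top) (hEt ▸ WithTop.coe_ne_top)
    have h' := (add_le_add (hy.2 (D ∩ E)) (hx.2 (D ∪ E))).trans h
    rw [← hDt, ← hEt] at h'
    norm_cast at h'
    have e₁ := Finset.sum_inter_add_sum_sdiff D E y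
    have e₂ := Finset.sum_sdiff (f := x) (Finset.subset_union_right (s₁ := D) (s₂ := E))
    rw [Finset.union_sdiff_right] at e₂
    linarith
  exact ⟨t, ht, exists_transfer_mem hx fun Z hZ htZ => by_contra fun hsZ => htE (hE' Z hZ hsZ htZ),
    exists_transfer_mem hy fun Z hZ hsZ => hD' Z hZ hsZ htD⟩

theorem sum_le_of_forall_integralPoints {S : Type*} {B : Set (S → ℝ)} (hB : IsIntegralPolyhedron B)
    {Z : Finset S} {c : ℝ} (h : ∀ z ∈ integralPoints B, (∑ v ∈ Z, (z v : ℝ)) ≤ c)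
    {x : S → ℝ} (hx : x ∈ B) : ∑ v ∈ Z, x v ≤ c := by
  have hconv : Convex ℝ {x : S → ℝ | ∑ v ∈ Z, x v ≤ c} := by
    have := convex_halfSpace_le (𝕜 := ℝ) (f := fun x : S → ℝ => ∑ v ∈ Z, x v)
      ⟨fun x y => by simp [Finset.sum_add_distrib], fun a x => by simp [Finset.mul_sum]⟩ c
    exact this
  have hsub := convexHull_min (𝕜 := ℝ)
    (s := (fun (z : S → ℤ) (s : S) => (z s : ℝ)) '' integralPoints B) (by
      rintro _ ⟨z, hz, rfl⟩
      exact h z hz) hconv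
  rw [hB] at hsub
  exact hsub hx

/-- In an integral base-polyhedron, a feasible direction at an integral point allows a unit step. -/
theorem transfer_one_mem (hB : IsIntegralPolyhedron (basePolyhedron b)) {m : S → ℤ}
    (hm : m ∈ integralPoints (basePolyhedron b)) {s t : S} {ε : ℝ} (hε : 0 < ε)
    (h : transfer (fun v => (m v : ℝ)) s t ε ∈ basePolyhedron b) :
    transfer m s t 1 ∈ integralPoints (basePolyhedron b) := by
  have hm' : (fun v => (m v : ℝ)) ∈ basePolyhedron b := hm
  have hcast : (fun v => ((transfer m s t 1 v : ℤ) : ℝ)) = transfer (fun v => (m v : ℝ)) s t 1 := by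
    funext v
    simp [transfer, Pi.single_apply]
  change (fun v => ((transfer m s t 1 v : ℤ) : ℝ)) ∈ basePolyhedron b
  rw [hcast]
  refine ⟨?_, fun Z => ?_⟩
  · rw [sum_transfer]
    simpa using hm'.1
  rw [sum_transfer]
  by_cases hZ : t ∈ Z ∧ s ∉ Z
  · by_contra hlt
    rw [not_le] at hlt
    have hle : ∀ z ∈ integralPoints (basePolyhedron b),
        (∑ v ∈ Z, (z v : ℝ)) ≤ ∑ v ∈ Z, (m v : ℝ) := by
      intro z hz
      have := (hz.2 Z).trans_lt hlt
      simp only [hZ.1, hZ.2, if_true, if_false, sub_zero] at this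
      norm_cast at this ⊢
      exact Int.lt_add_one_iff.1 this
    have := sum_le_of_forall_integralPoints hB hle h
    rw [sum_transfer] at this
    simp only [hZ.1, hZ.2, if_true, if_false] at this
    linarith
  · refine le_trans (WithTop.coe_le_coe.2 ?_) (hm'.2 Z)
    by_cases hs : s ∈ Z <;> by_cases ht' : t ∈ Z <;> simp_all

/-- If `m s ≥ m t + 2`, a unit step leaves both components below `m s`. -/
theorem IsDecMin.le_add_one {Q : Set (S → ℤ)} {m : S → ℤ} (hm : IsDecMin Q m) {s t : S}
    (h : transfer m s t 1 ∈ Q) : m s ≤ m t + 1 := by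
  by_contra! hlt
  have hst : s ≠ t := by
    rintro rfl
    omega
  refine (decLT_of_transfer (s := s) (t := t) hst ?_ ?_ ?_ ?_).not_decLE (hm.2 _ h)
  · simp [transfer, hst]
  · simpa [transfer, hst.symm] using hlt
  · omega
  · intro r hrs hrt
    simp [transfer, hrs, hrt]

/-- Moving `a` changes the square-sum by `2a(a - (m s - m t))`, negative for `0 < a < m s - m t`. -/
theorem IsMinNormPoint.le_of_transfer {B : Set (S → ℝ)} {m : S → ℝ} (hm : IsMinNormPoint B m)
    {s t : S} {ε : ℝ} (hε : 0 < ε) (h : ∀ a, 0 ≤ a → a ≤ ε → transfer m s t a ∈ B) :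
    m s ≤ m t := by
  by_contra! hlt
  have hst : s ≠ t := by
    rintro rfl
    exact lt_irrefl _ hlt
  obtain ⟨a, ha, haε, had⟩ : ∃ a, 0 < a ∧ a ≤ ε ∧ a < m s - m t :=
    ⟨min ε ((m s - m t) / 2), lt_min hε (by linarith), min_le_left _ _,
      (min_le_right _ _).trans_lt (by linarith)⟩
  have hle := hm.2 _ (h a ha.le haε)
  have hsq : ∀ v, transfer m s t a v ^ 2 = m v ^ 2 + ((Pi.single t (2 * a * m t + a ^ 2) : S → ℝ) v
      + (Pi.single s (a ^ 2 - 2 * a * m s) : S → ℝ) v) := by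
    intro v
    by_cases hs : v = s
    · subst hs
      simp [transfer, hst]
      ring
    · by_cases ht : v = t
      · subst ht
        simp [transfer, hs]
        ring
      · simp [transfer, hs, ht]
  simp only [hsq, Finset.sum_add_distrib, Finset.sum_pi_single', Finset.mem_univ, if_true] at hle
  nlinarith [mul_pos ha (sub_pos.2 had)]

end Base

end DecMin

theorem mainTheorem1 {S : Type*} [Fintype S] [DecidableEq S] (B : Set (S → ℝ))
    (hB : DecMin.IsIntegralBasePolyhedron B)
    (mR : S → ℝ) (hmR : DecMin.IsMinNormPoint B mR)
    (mZ : S → ℤ) (hmZ : DecMin.IsDecMin (DecMin.integralPoints B) mZ) :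
    ∀ s : S, ⌊mR s⌋ ≤ mZ s ∧ mZ s ≤ ⌈mR s⌉ := by
  obtain ⟨⟨b, hb₀, hb, rfl⟩, hint⟩ := hB
  have hmem : (fun v => (mZ v : ℝ)) ∈ DecMin.basePolyhedron b := hmZ.1
  intro s
  constructor
  · by_contra! hlt
    have hle : (mZ s : ℝ) + 1 ≤ mR s :=
      le_trans (by exact_mod_cast hlt) (Int.floor_le (mR s))
    obtain ⟨t, ht, ⟨ε, hε, hR⟩, δ, hδ, hZ⟩ :=
      DecMin.exists_exchange hb₀ hb hmR.1 hmem (s := s) (by linarith)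
    have h₁ := hmR.le_of_transfer hε hR
    have h₂ := hmZ.le_add_one (DecMin.transfer_one_mem hint hmZ.1 hδ (hZ δ hδ.le le_rfl))
    have h₃ : (mZ t : ℝ) ≤ mZ s + 1 := by exact_mod_cast h₂
    linarith
  · by_contra! hlt
    have hle : mR s + 1 ≤ mZ s :=
      le_trans (by linarith [Int.le_ceil (mR s)] : mR s + 1 ≤ (⌈mR s⌉ : ℝ) + 1)
        (by exact_mod_cast hlt)
    obtain ⟨t, ht, ⟨δ, hδ, hZ⟩, ε, hε, hR⟩ :=
      DecMin.exists_exchange hb₀ hb hmem hmR.1 (s := s) (by linarith)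
    have h₁ := hmR.le_of_transfer hε hR
    have h₂ := hmZ.le_add_one (DecMin.transfer_one_mem hint hmZ.1 hδ (hZ δ hδ.le le_rfl))
    have h₃ : (mZ s : ℝ) ≤ mZ t + 1 := by exact_mod_cast h₂
    linarith
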